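/- \textbf{Witte's theorem.} Let $G$ be a group (with the discrete topology). Suppose that $G$ is amenable, i.e. there is a positive linear functional $m : \ell^\infty(G,\mathbb{R}) \to \mathbb{R}$ with $m(1) = 1$ that is invariant under left translations. Suppose also that $G$ is left-orderable, i.e. it admits a total order that is invariant under left multiplications. Then $G$ is locally indicable: every nontrivial finitely generated subgroup $H \le G$ admits a nontrivial homomorphism $H \to \mathbb{Z}$. -/

import Mathlib

open scoped ENNReal

/-- The left translate `x ↦ f (g⁻¹ * x)` of a bounded real function `f ∈ ℓ^∞(G)`. -/
noncomputable def leftTranslate {G : Type*} [Group G] (g : G) (f : lp (fun _ : G => ℝ) ∞) :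
    lp (fun _ : G => ℝ) ∞ :=
  ⟨fun x => f (g⁻¹ * x), by
    have hf : Memℓp (f : G → ℝ) ∞ := lp.memℓp f
    rw [memℓp_infty_iff] at hf
    refine memℓp_infty (hf.mono ?_)
    rintro _ ⟨x, rfl⟩
    exact ⟨g⁻¹ * x, rfl⟩⟩

/-- A left-invariant mean on `G`: a positive, normalized linear functional on `ℓ^∞(G)` which is
invariant under left translations. -/
structure IsLeftInvariantMean {G : Type*} [Group G] (m : lp (fun _ : G => ℝ) ∞ →ₗ[ℝ] ℝ) :
    Prop where
  nonneg : ∀ f : lp (fun _ : G => ℝ) ∞, (∀ x, 0 ≤ f x) → 0 ≤ m f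
  map_one : m 1 = 1
  map_leftTranslate : ∀ (g : G) (f : lp (fun _ : G => ℝ) ∞), m (leftTranslate g f) = m f

/-- A (discrete) group is amenable if it carries a left-invariant mean. -/
def IsAmenableGroup (G : Type*) [Group G] : Prop :=
  ∃ m : lp (fun _ : G => ℝ) ∞ →ₗ[ℝ] ℝ, IsLeftInvariantMean m

/-- A group is left-orderable if it admits a total order invariant under left multiplications. -/
def IsLeftOrderable (G : Type*) [Group G] : Prop :=
  ∃ _ : LinearOrder G, ∀ a b c : G, b ≤ c → a * b ≤ a * c

/-- A group is locally indicable if every nontrivial finitely generated subgroup has a nontrivial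
homomorphism to `ℤ`. -/
def IsLocallyIndicable (G : Type*) [Group G] : Prop :=
  ∀ H : Subgroup G, H.FG → H ≠ ⊥ → ∃ φ : H →* Multiplicative ℤ, φ ≠ 1

/-! Each point `x` of the ordered group compares `a` with `1` through `a * x` versus `x`. For fixed
`g`, `h`, the points at which Conrad's inequality `h < g * h ^ 2` fails form a set wandering under
`g * h`, hence null for an invariant mean (`indicator_eq_zero_of_wandering`). An ultrafilter
avoiding all null sets picks one limit order satisfying every Conrad inequality at once
(`exists_isConradian`). In a finitely generated Conradian group some `f > 1` has cofinal powers. The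
elements infinitesimal relative to `f` form a normal convex subgroup with Archimedean quotient,
which is abelian by Hölder's argument (`mul_comm_of_archimedean`). That quotient is finitely
generated, torsion-free and nontrivial, so it maps onto a nonzero subgroup of `ℤ`. -/

section LeftOrders

variable {G : Type*} [Group G]

/-- A positive cone of a left order on a group. -/
structure IsPositiveCone (P : Set G) : Prop where
  mul_mem : ∀ {a b : G}, a ∈ P → b ∈ P → a * b ∈ P
  one_notMem : (1 : G) ∉ P
  mem_or_inv_mem : ∀ {a : G}, a ≠ 1 → a ∈ P ∨ a⁻¹ ∈ P

/-- The left order with a given positive cone. -/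
@[reducible] noncomputable def IsPositiveCone.linearOrder {P : Set G} (hP : IsPositiveCone P) :
    LinearOrder G where
  le a b := a = b ∨ a⁻¹ * b ∈ P
  le_refl a := Or.inl rfl
  le_trans a b c := by
    rintro (rfl | hab) (rfl | hbc)
    · exact Or.inl rfl
    · exact Or.inr hbc
    · exact Or.inr hab
    · exact Or.inr (by simpa [mul_assoc] using hP.mul_mem hab hbc)
  le_antisymm a b := by
    rintro (rfl | hab) (hba | hba)
    · rfl
    · rfl
    · exact hba.symm
    · exact absurd (by simpa [mul_assoc] using hP.mul_mem hab hba) hP.one_notMem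
  le_total a b := by
    by_cases h : a = b
    · exact Or.inl (Or.inl h)
    · rcases hP.mem_or_inv_mem (a := a⁻¹ * b) (by rwa [ne_eq, inv_mul_eq_one]) with h | h
      · exact Or.inl (Or.inr h)
      · exact Or.inr (Or.inr (by simpa using h))
  toDecidableLE := Classical.decRel _

theorem IsPositiveCone.mulLeftMono {P : Set G} (hP : IsPositiveCone P) :
    letI := hP.linearOrder
    MulLeftMono G := by
  let := hP.linearOrder
  refine ⟨fun a b c h => ?_⟩
  rcases h with rfl | h
  · exact le_refl _
  · exact Or.inr (by simpa [mul_assoc] using h)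

theorem IsPositiveCone.one_lt_iff {P : Set G} (hP : IsPositiveCone P) {a : G} :
    letI := hP.linearOrder
    1 < a ↔ a ∈ P := by
  let := hP.linearOrder
  constructor
  · intro h
    rcases h.le with rfl | h'
    · exact absurd h (lt_irrefl _)
    · simpa using h'
  · intro h
    refine lt_of_le_of_ne (Or.inr (by simpa using h)) ?_
    rintro rfl
    exact hP.one_notMem h

end LeftOrders

/-! ### Hölder's theorem -/

section Archimedean

variable {Q : Type*} [Group Q] [LinearOrder Q] [MulLeftMono Q]

theorem one_lt_conj_of_archimedean (arch : ∀ x : Q, 1 < x → ∀ y, ∃ n : ℕ, y ≤ x ^ n)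
    {x : Q} (hx : 1 < x) (g : Q) : 1 < g * x * g⁻¹ := by
  by_contra hcon
  have hy : g * x * g⁻¹ < 1 := lt_of_le_of_ne (not_lt.1 hcon) fun h => by
    rw [mul_inv_eq_one, mul_eq_left] at h
    exact hx.ne' h
  have hy' : 1 < (g * x * g⁻¹)⁻¹ := Left.one_lt_inv_iff.2 hy
  -- For large `N`, `g⁻¹ < x ^ N` gives `1 < g * x ^ N`, while `g < (g * x * g⁻¹)⁻¹ ^ N` gives `g *
  -- x ^ N < 1`.
  obtain ⟨n, hn⟩ := arch x hx g⁻¹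
  obtain ⟨k, hk⟩ := arch _ hy' g
  have h1 : g⁻¹ < x ^ (n + k + 1) :=
    hn.trans_lt (pow_lt_pow_right' hx (by omega))
  have h2 : g < (g * x * g⁻¹)⁻¹ ^ (n + k + 1) :=
    hk.trans_lt (pow_lt_pow_right' hy' (by omega))
  rw [inv_pow, conj_pow, mul_inv_rev, mul_inv_rev, inv_inv] at h2
  have h3 : 1 < g * x ^ (n + k + 1) := inv_lt_iff_one_lt_mul'.1 h1
  have h4 : g * x ^ (n + k + 1) < 1 := by
    have := mul_lt_mul_right h2 (g * x ^ (n + k + 1) * g⁻¹)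
    simpa [mul_assoc] using this
  exact lt_asymm h3 h4

theorem mulRightMono_of_archimedean
    (arch : ∀ x : Q, 1 < x → ∀ y, ∃ n : ℕ, y ≤ x ^ n) : MulRightMono Q := by
  refine ⟨fun c a b hab => ?_⟩
  rcases hab.eq_or_lt with rfl | hab
  · exact le_rfl
  have h := one_lt_conj_of_archimedean arch (lt_inv_mul_iff_mul_lt.2 (by simpa using hab) :
    1 < a⁻¹ * b) c⁻¹
  have := mul_lt_mul_right h (a * c)
  simpa [Function.swap, mul_assoc] using this.le

theorem exists_zpow_near_of_archimedean
    (arch : ∀ x : Q, 1 < x → ∀ y, ∃ n : ℕ, y ≤ x ^ n) {d : Q} (hd : 1 < d) (x : Q) :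
    ∃ a : ℤ, d ^ a ≤ x ∧ x < d ^ (a + 1) := by
  obtain ⟨n, hn⟩ := arch d hd x
  obtain ⟨k, hk⟩ := arch d hd x⁻¹
  have mono : StrictMono fun z : ℤ => d ^ z := fun p q hpq => by
    obtain ⟨r, rfl⟩ := Int.exists_add_of_le hpq.le
    have hr : r ≠ 0 := by rintro rfl; simp at hpq
    simp only [zpow_add, zpow_natCast]
    exact lt_mul_of_one_lt_right' _ (one_lt_pow' hd hr)
  have := mulRightMono_of_archimedean arch
  have hlow : d ^ (-(k : ℤ)) ≤ x := by
    rw [zpow_neg, zpow_natCast]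
    exact inv_le_of_inv_le' hk
  obtain ⟨a, ha, hmax⟩ := Int.exists_greatest_of_bdd (P := fun z : ℤ => d ^ z ≤ x)
    ⟨n, fun z hz => mono.le_iff_le.1 (hz.trans (by simpa using hn))⟩ ⟨_, hlow⟩
  refine ⟨a, ha, lt_of_not_ge fun h => ?_⟩
  have := hmax _ h
  omega

theorem commutator_lt_sq_of_archimedean
    (arch : ∀ x : Q, 1 < x → ∀ y, ∃ n : ℕ, y ≤ x ^ n) (x y : Q) {d : Q} (hd : 1 < d) :
    (y * x)⁻¹ * (x * y) < d * d := by
  have := mulRightMono_of_archimedean arch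
  obtain ⟨a, ha, ha'⟩ := exists_zpow_near_of_archimedean arch hd x
  obtain ⟨b, hb, hb'⟩ := exists_zpow_near_of_archimedean arch hd y
  rw [inv_mul_lt_iff_lt_mul]
  calc x * y < d ^ (a + 1) * d ^ (b + 1) := mul_lt_mul_of_lt_of_lt ha' hb'
    _ = d ^ b * d ^ a * (d * d) := by group
    _ ≤ y * x * (d * d) := mul_le_mul_left (mul_le_mul' hb ha) _

/-- A left order all of whose positive elements have cofinal powers forces commutativity. -/
theorem mul_comm_of_archimedean (arch : ∀ x : Q, 1 < x → ∀ y, ∃ n : ℕ, y ≤ x ^ n) (x y : Q) :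
    x * y = y * x := by
  have := mulRightMono_of_archimedean arch
  by_contra hne
  wlog hlt : y * x < x * y generalizing x y
  · exact this y x (Ne.symm hne) (lt_of_le_of_ne (not_lt.1 hlt) hne)
  set e := (y * x)⁻¹ * (x * y)
  have he1 : 1 < e := lt_inv_mul_iff_mul_lt.2 (by simpa using hlt)
  have hsq : ∀ d : Q, 1 < d → e < d * d := fun d hd => commutator_lt_sq_of_archimedean arch x y hd
  -- If `1 < d < e`, the smaller of `d` and `d⁻¹ * e` has square at most `e`, against `hsq`. So `e`
  -- is the least positive element and generates `Q`.
  have hmin : ∀ d : Q, 1 < d → e ≤ d := by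
    intro d hd
    by_contra! hde
    have hd' : 1 < d⁻¹ * e := lt_inv_mul_iff_mul_lt.2 (by simpa using hde)
    rcases le_total d (d⁻¹ * e) with h | h
    · have := mul_le_mul_right h d
      rw [mul_inv_cancel_left] at this
      exact absurd (hsq d hd) (not_lt.2 this)
    · have := mul_le_mul_left h (d⁻¹ * e)
      rw [mul_inv_cancel_left] at this
      exact absurd (hsq _ hd') (not_lt.2 this)
  have hpow : ∀ z : Q, ∃ a : ℤ, z = e ^ a := by
    intro z
    obtain ⟨a, ha, ha'⟩ := exists_zpow_near_of_archimedean arch he1 z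
    refine ⟨a, ?_⟩
    by_contra hz
    have h1 : 1 < (e ^ a)⁻¹ * z :=
      lt_inv_mul_iff_mul_lt.2 (by simpa using lt_of_le_of_ne ha (Ne.symm hz))
    have h2 : (e ^ a)⁻¹ * z < e := by
      rw [inv_mul_lt_iff_lt_mul, ← zpow_add_one]
      exact ha'
    exact absurd (hmin _ h1) (not_le.2 h2)
  obtain ⟨a, ha⟩ := hpow x
  obtain ⟨b, hb⟩ := hpow y
  apply hne
  rw [ha, hb, ← zpow_add, ← zpow_add, add_comm]

end Archimedean

/-- A nontrivial finitely generated torsion-free abelian group maps nontrivially to `ℤ`. -/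
theorem exists_hom_int_ne_one_of_fg (A : Type*) [CommGroup A] [Group.FG A] [Nontrivial A]
    (htf : ∀ (a : A) (n : ℕ), n ≠ 0 → a ^ n = 1 → a = 1) :
    ∃ φ : A →* Multiplicative ℤ, φ ≠ 1 := by
  have hfin : Module.Finite ℤ (Additive A) := Module.Finite.iff_addGroup_fg.2 inferInstance
  have htors : Module.IsTorsionFree ℤ (Additive A) := by
    have : IsAddTorsionFree (Additive A) := ⟨fun n hn a b hab => by
      have h : (a - b) = 0 := htf (a - b).toMul n hn (by
        change n • (a - b) = 0
        rw [smul_sub, sub_eq_zero]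
        exact hab)
      exact sub_eq_zero.1 h⟩
    infer_instance
  have hfree : Module.Free ℤ (Additive A) := Module.free_of_finite_type_torsion_free'
  obtain ⟨a, ha⟩ := exists_ne (1 : A)
  have : ∃ f : Module.Dual ℤ (Additive A), f (Additive.ofMul a) ≠ 0 := by
    by_contra! h
    exact ha ((Module.forall_dual_apply_eq_zero_iff ℤ (Additive.ofMul a)).1 h)
  obtain ⟨f, hf⟩ := this
  refine ⟨AddMonoidHom.toMultiplicativeRight f.toAddMonoidHom, fun h => hf ?_⟩
  have := DFunLike.congr_fun h a
  exact this

/-! ### Convex subgroups of Conradian groups -/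

section Conradian

variable {H : Type*} [Group H] [LinearOrder H] [MulLeftMono H]

/-- Conrad's condition on a left order. -/
def IsConradian (H : Type*) [Group H] [LinearOrder H] : Prop :=
  ∀ g h : H, 1 < g → 1 < h → h < g * h ^ 2

/-- This is Conrad's condition for the pair `x⁻¹ * u ^ k`, `u ^ n`. It makes the elements bounded by
powers of `u` closed under products. -/
theorem IsConradian.mul_pow_le (hC : IsConradian H) {u x : H} (hu : 1 ≤ u) {k : ℕ}
    (hx : x ≤ u ^ k) (n : ℕ) : x * u ^ n ≤ u ^ (k + 2 * n) := by
  rcases hx.eq_or_lt with rfl | hx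
  · rw [← pow_add]
    exact pow_le_pow_right' hu (by omega)
  have hy : 1 < x⁻¹ * u ^ k := lt_inv_mul_iff_mul_lt.2 (by simpa using hx)
  rcases (one_le_pow_of_one_le' hu n).eq_or_lt with h | h
  · rw [mul_comm 2 n, pow_add, pow_mul, ← h]
    simpa using hx.le
  · have := (mul_lt_mul_right (hC _ _ hy h) x).le
    rwa [← pow_mul, mul_assoc, mul_inv_cancel_left, ← pow_add, mul_comm n 2] at this

/-- The convex subgroup generated by an element of a Conradian group. -/
def IsConradian.convexClosure (hC : IsConradian H) (u : H) (hu : 1 ≤ u) : Subgroup H where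
  carrier := {x | ∃ n : ℕ, x ≤ u ^ n ∧ x⁻¹ ≤ u ^ n}
  one_mem' := ⟨0, by simp⟩
  inv_mem' := by
    rintro x ⟨n, h1, h2⟩
    exact ⟨n, h2, by simpa using h1⟩
  mul_mem' := by
    rintro x y ⟨k, h1, h2⟩ ⟨n, h3, h4⟩
    refine ⟨2 * k + 2 * n, ?_, ?_⟩
    · exact (mul_le_mul_right h3 x).trans ((hC.mul_pow_le hu h1 n).trans
        (pow_le_pow_right' hu (by omega)))
    · rw [mul_inv_rev]
      exact (mul_le_mul_right h2 _).trans ((hC.mul_pow_le hu h4 k).trans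
        (pow_le_pow_right' hu (by omega)))

theorem IsConradian.exists_cofinal (hC : IsConradian H) [Group.FG H] [Nontrivial H] :
    ∃ f : H, 1 < f ∧ ∀ x : H, ∃ n : ℕ, x ≤ f ^ n := by
  obtain ⟨T, hT⟩ := Group.FG.out (G := H)
  obtain ⟨a, ha⟩ := exists_ne (1 : H)
  obtain ⟨b, hb⟩ : ∃ b : H, 1 < b := by
    rcases lt_or_gt_of_ne ha with h | h
    · exact ⟨_, Left.one_lt_inv_iff.2 h⟩
    · exact ⟨a, h⟩
  classical
  -- Including `b` forces `M > 1`.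
  obtain ⟨M, hM⟩ := (insert b (T ∪ T.image (·⁻¹))).bddAbove
  have hfb : b ≤ M := hM (by simp)
  have hf1 : 1 < M := hb.trans_le hfb
  refine ⟨M, hf1, fun x => ?_⟩
  have htop : hC.convexClosure M hf1.le = ⊤ := by
    rw [eq_top_iff, ← hT, Subgroup.closure_le]
    intro t ht
    have ht' : t ∈ T := ht
    refine ⟨1, ?_, ?_⟩
    · rw [pow_one]
      exact hM (by simp [ht'])
    · rw [pow_one]
      exact hM (by simp [ht'])
  obtain ⟨n, hn, -⟩ : x ∈ hC.convexClosure M hf1.le := htop ▸ Subgroup.mem_top x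
  exact ⟨n, hn⟩

theorem IsConradian.pow_lt_of_mem_convexClosure (hC : IsConradian H) {f u x : H} (hu : 1 ≤ u)
    (huf : ∀ n : ℕ, u ^ n < f) (hx : x ∈ hC.convexClosure u hu) (n : ℕ) :
    x ^ n < f ∧ x⁻¹ ^ n < f := by
  obtain ⟨k, hk, -⟩ := pow_mem hx n
  obtain ⟨l, hl, -⟩ := pow_mem (inv_mem hx) n
  exact ⟨hk.trans_lt (huf k), hl.trans_lt (huf l)⟩

/-- The elements that are infinitesimal with respect to `f`. -/
def IsConradian.infinitesimals (hC : IsConradian H) (f : H) (hf : 1 < f) : Subgroup H where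
  carrier := {x | ∀ n : ℕ, x ^ n < f ∧ x⁻¹ ^ n < f}
  one_mem' n := by simpa using hf
  inv_mem' := by
    intro x hx n
    exact ⟨(hx n).2, by simpa using (hx n).1⟩
  mul_mem' := by
    intro x y hx hy
    have key : ∀ z : H, (∀ n : ℕ, z ^ n < f ∧ z⁻¹ ^ n < f) →
        ∃ u : H, 1 ≤ u ∧ z ≤ u ∧ z⁻¹ ≤ u ∧ ∀ n : ℕ, u ^ n < f := by
      intro z hz
      rcases le_total 1 z with h | h
      · exact ⟨z, h, le_rfl, (Left.inv_le_one_iff.2 h).trans h, fun n => (hz n).1⟩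
      · exact ⟨z⁻¹, Left.one_le_inv_iff.2 h, h.trans (Left.one_le_inv_iff.2 h), le_rfl,
          fun n => (hz n).2⟩
    obtain ⟨u, hu, hxu, hxu', huf⟩ := key x hx
    obtain ⟨v, hv, hyv, hyv', hvf⟩ := key y hy
    have hw : ∀ n : ℕ, (max u v) ^ n < f := by
      rcases max_choice u v with h | h <;> rw [h] <;> assumption
    have hw1 : 1 ≤ max u v := le_max_of_le_left hu
    refine hC.pow_lt_of_mem_convexClosure hw1 hw (mul_mem ⟨1, ?_, ?_⟩ ⟨1, ?_, ?_⟩) <;>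
      rw [pow_one]
    · exact le_max_of_le_left hxu
    · exact le_max_of_le_left hxu'
    · exact le_max_of_le_right hyv
    · exact le_max_of_le_right hyv'

theorem IsConradian.mem_infinitesimals_of_le (hC : IsConradian H) {f : H} (hf : 1 < f) {x c : H}
    (hx : 1 ≤ x) (hxc : x ≤ c) (hc : c ∈ hC.infinitesimals f hf) :
    x ∈ hC.infinitesimals f hf :=
  hC.pow_lt_of_mem_convexClosure (hx.trans hxc) (fun n => (hc n).1)
    ⟨1, by simpa using hxc, by simpa using (Left.inv_le_one_iff.2 hx).trans (hx.trans hxc)⟩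

theorem IsConradian.exists_le_pow (hC : IsConradian H) {f : H} (hf : 1 < f)
    (hcof : ∀ x : H, ∃ n : ℕ, x ≤ f ^ n) {x : H} (hx : 1 < x)
    (hxC : x ∉ hC.infinitesimals f hf) (y : H) : ∃ n : ℕ, y ≤ x ^ n := by
  have : ∃ n : ℕ, f ≤ x ^ n := by
    by_contra! h
    exact hxC fun n => ⟨h n, (pow_le_one' (Left.inv_le_one_iff.2 hx.le) n).trans_lt hf⟩
  obtain ⟨n, hn⟩ := this
  have hfx : f ∈ hC.convexClosure x hx.le :=
    ⟨n, hn, (Left.inv_le_one_iff.2 hf.le).trans (one_le_pow_of_one_le' hx.le n)⟩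
  obtain ⟨k, hk⟩ := hcof y
  obtain ⟨l, hl, -⟩ := pow_mem hfx k
  exact ⟨l, hk.trans hl⟩

theorem IsConradian.infinitesimals_normal (hC : IsConradian H) {f : H} (hf : 1 < f)
    (hcof : ∀ x : H, ∃ n : ℕ, x ≤ f ^ n) : (hC.infinitesimals f hf).Normal := by
  refine ⟨fun c hc k => ?_⟩
  by_contra hd
  wlog h1 : 1 < k * c * k⁻¹ generalizing c
  · refine this c⁻¹ (inv_mem hc) (fun h => hd ?_) ?_
    · simpa [mul_assoc] using inv_mem h
    · have hne : k * c * k⁻¹ ≠ 1 := fun h => hd (h ▸ one_mem _)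
      have := Left.one_lt_inv_iff.2 (lt_of_le_of_ne (not_lt.1 h1) hne)
      simpa [mul_assoc] using this
  -- A non-infinitesimal positive conjugate would have cofinal powers, yet `k * c ^ n * k⁻¹ ≤ k * c
  -- ^ n * f ^ b`, which is bounded independently of `n`.
  obtain ⟨b, hb⟩ := hcof k⁻¹
  obtain ⟨n, hn⟩ := hC.exists_le_pow hf hcof h1 hd (k * f ^ (1 + 2 * b) * f)
  have h2 : c ^ n * f ^ b ≤ f ^ (1 + 2 * b) :=
    hC.mul_pow_le hf.le (by simpa using (hc n).1.le) b
  have h3 : (k * c * k⁻¹) ^ n ≤ k * f ^ (1 + 2 * b) := by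
    rw [conj_pow, mul_assoc]
    exact mul_le_mul_right ((mul_le_mul_right hb _).trans h2) k
  exact absurd (hn.trans h3) (not_le.2 (lt_mul_of_one_lt_right' _ hf))

theorem IsConradian.isPositiveCone_quotient (hC : IsConradian H) {f : H} (hf : 1 < f)
    [(hC.infinitesimals f hf).Normal] :
    IsPositiveCone {q : H ⧸ hC.infinitesimals f hf |
      ∃ x : H, 1 < x ∧ x ∉ hC.infinitesimals f hf ∧ (x : H ⧸ hC.infinitesimals f hf) = q} where
  mul_mem := by
    rintro _ _ ⟨x, hx, hxC, rfl⟩ ⟨y, hy, hyC, rfl⟩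
    refine ⟨x * y, one_lt_mul'' hx hy, fun h => hxC ?_, rfl⟩
    exact hC.mem_infinitesimals_of_le hf hx.le (lt_mul_of_one_lt_right' _ hy).le h
  one_notMem := by
    rintro ⟨x, -, hxC, h⟩
    exact hxC ((QuotientGroup.eq_one_iff x).1 h)
  mem_or_inv_mem := by
    intro a ha
    induction a using QuotientGroup.induction_on with
    | H x =>
      have hxC : x ∉ hC.infinitesimals f hf := fun h => ha ((QuotientGroup.eq_one_iff x).2 h)
      have hne : x ≠ 1 := fun h => hxC (h ▸ one_mem _)
      rcases lt_or_gt_of_ne hne with h | h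
      · exact Or.inr ⟨x⁻¹, Left.one_lt_inv_iff.2 h, fun h => hxC (by simpa using h), rfl⟩
      · exact Or.inl ⟨x, h, hxC, rfl⟩

/-- A nontrivial finitely generated group with a Conradian left order maps nontrivially to `ℤ`. -/
theorem IsConradian.exists_hom_int_ne_one (hC : IsConradian H) [Group.FG H] [Nontrivial H] :
    ∃ φ : H →* Multiplicative ℤ, φ ≠ 1 := by
  obtain ⟨f, hf, hcof⟩ := hC.exists_cofinal
  set C := hC.infinitesimals f hf
  have hnormal : C.Normal := hC.infinitesimals_normal hf hcof
  have hP := hC.isPositiveCone_quotient hf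
  have hfC : f ∉ C := fun h => by simpa using (h 1).1
  let := hP.linearOrder
  have := hP.mulLeftMono
  have arch : ∀ p : H ⧸ C, 1 < p → ∀ q, ∃ n : ℕ, q ≤ p ^ n := by
    intro p hp q
    obtain ⟨x, hx, hxC, rfl⟩ := hP.one_lt_iff.1 hp
    induction q using QuotientGroup.induction_on with
    | H y =>
      obtain ⟨n, hn⟩ := hC.exists_le_pow hf hcof hx hxC y
      refine ⟨n, ?_⟩
      by_cases h : y⁻¹ * x ^ n ∈ C
      · exact Or.inl (QuotientGroup.eq.2 h)
      · refine Or.inr ⟨y⁻¹ * x ^ n, lt_of_le_of_ne ?_ fun h' => h (h' ▸ one_mem _), h, rfl⟩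
        exact le_inv_mul_iff_mul_le.2 (by simpa using hn)
  let : CommGroup (H ⧸ C) := { (inferInstance : Group (H ⧸ C)) with
    mul_comm := mul_comm_of_archimedean arch }
  have hfg : Group.FG (H ⧸ C) := QuotientGroup.fg C
  have hnt : Nontrivial (H ⧸ C) :=
    ⟨⟨(f : H ⧸ C), 1, fun h => hfC ((QuotientGroup.eq_one_iff f).1 h)⟩⟩
  obtain ⟨φ, hφ⟩ := exists_hom_int_ne_one_of_fg (H ⧸ C) fun a n hn ha => by
    by_contra hne
    rcases lt_or_gt_of_ne hne with h | h
    · exact (pow_lt_one' h hn).ne ha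
    · exact (one_lt_pow' h hn).ne' ha
  refine ⟨φ.comp (QuotientGroup.mk' C), fun h => hφ ?_⟩
  refine MonoidHom.ext fun q => ?_
  induction q using QuotientGroup.induction_on with
  | H x => exact DFunLike.congr_fun h x

end Conradian

/-! ### Invariant means and limit orders -/

section Means

variable {G : Type*}

/-- The indicator function of a set as a bounded function. -/
noncomputable def boundedIndicator (A : Set G) : lp (fun _ : G => ℝ) ∞ :=
  ⟨A.indicator 1, memℓp_infty ⟨1, by
    rintro _ ⟨x, rfl⟩
    by_cases h : x ∈ A <;> simp [h]⟩⟩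

theorem boundedIndicator_apply (A : Set G) (x : G) :
    boundedIndicator A x = A.indicator (1 : G → ℝ) x := rfl

variable [Group G]

theorem leftTranslate_apply (g : G) (f : lp (fun _ : G => ℝ) ∞) (x : G) :
    leftTranslate g f x = f (g⁻¹ * x) := rfl

namespace IsLeftInvariantMean

variable {m : lp (fun _ : G => ℝ) ∞ →ₗ[ℝ] ℝ}

theorem mono (hm : IsLeftInvariantMean m) {f g : lp (fun _ : G => ℝ) ∞}
    (h : ∀ x, f x ≤ g x) : m f ≤ m g := by
  have := hm.nonneg (g - f) fun x => by simpa using h x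
  rw [map_sub] at this
  linarith

theorem indicator_nonneg (hm : IsLeftInvariantMean m) (A : Set G) :
    0 ≤ m (boundedIndicator A) :=
  hm.nonneg _ fun _ => Set.indicator_nonneg (fun _ _ => zero_le_one) _

/-- A set disjoint from all its translates by positive powers of an element is null. -/
theorem indicator_eq_zero_of_wandering (hm : IsLeftInvariantMean m) {A : Set G} {k : G}
    (hk : ∀ n : ℕ, n ≠ 0 → ∀ x ∈ A, k ^ n * x ∉ A) : m (boundedIndicator A) = 0 := by
  have hbound : ∀ N : ℕ, N * m (boundedIndicator A) ≤ 1 := by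
    intro N
    have hsum : m (∑ i ∈ Finset.range N, leftTranslate (k ^ i) (boundedIndicator A)) =
        N * m (boundedIndicator A) := by
      simp [map_sum, hm.map_leftTranslate]
    rw [← hsum, ← hm.map_one]
    refine hm.mono fun x => ?_
    have hone : (1 : lp (fun _ : G => ℝ) ∞) x = 1 := rfl
    rw [hone, lp.coeFn_sum, Finset.sum_apply]
    simp only [leftTranslate_apply, boundedIndicator_apply]
    -- At most one of the `N` translates contains `x`, by wandering.
    by_cases hex : ∃ i ∈ Finset.range N, (k ^ i)⁻¹ * x ∈ A
    · obtain ⟨i, hi, hiA⟩ := hex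
      rw [Finset.sum_eq_single_of_mem i hi]
      · simp [hiA]
      · intro j _ hji
        refine Set.indicator_of_notMem (fun hjA => ?_) _
        rcases lt_or_gt_of_ne hji with h | h
        · refine hk (i - j) (by omega) _ hiA ?_
          rw [← mul_assoc, pow_sub _ h.le, mul_assoc]
          rwa [show k ^ i * (k ^ j)⁻¹ = (k ^ j)⁻¹ * k ^ i from
            ((Commute.pow_pow_self k i j).inv_right).eq, mul_assoc, mul_inv_cancel_left]
        · refine hk (j - i) (by omega) _ hjA ?_
          rw [← mul_assoc, pow_sub _ h.le, mul_assoc]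
          rwa [show k ^ j * (k ^ i)⁻¹ = (k ^ i)⁻¹ * k ^ j from
            ((Commute.pow_pow_self k j i).inv_right).eq, mul_assoc, mul_inv_cancel_left]
    · push Not at hex
      rw [Finset.sum_eq_zero fun i hi => Set.indicator_of_notMem (hex i hi) _]
      exact zero_le_one
  refine le_antisymm (le_of_not_gt fun hpos => ?_) (hm.indicator_nonneg A)
  obtain ⟨N, hN⟩ := exists_nat_gt (1 / m (boundedIndicator A))
  rw [div_lt_iff₀ hpos] at hN
  exact absurd (hbound N) (not_le.2 hN)

/-- The filter of sets whose complement is null for the mean. -/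
def conullFilter (hm : IsLeftInvariantMean m) : Filter G where
  sets := {A | m (boundedIndicator Aᶜ) = 0}
  univ_sets := by
    have : boundedIndicator (Set.univ : Set G)ᶜ = 0 := by
      ext x
      simp [boundedIndicator_apply]
    simp only [Set.mem_ofPred_eq, this, map_zero]
  sets_of_superset := by
    intro A B hA hAB
    refine le_antisymm (le_trans (hm.mono fun x => ?_) (le_of_eq hA)) (hm.indicator_nonneg _)
    exact Set.indicator_le_indicator_of_subset (Set.compl_subset_compl.2 hAB)
      (fun _ => zero_le_one) x
  inter_sets := by
    intro A B hA hB
    have h : m (boundedIndicator Aᶜ + boundedIndicator Bᶜ) = 0 := by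
      rw [map_add, show m (boundedIndicator Aᶜ) = 0 from hA,
        show m (boundedIndicator Bᶜ) = 0 from hB, add_zero]
    refine le_antisymm (le_trans (hm.mono fun x => ?_) (le_of_eq h)) (hm.indicator_nonneg _)
    rw [lp.coeFn_add, Pi.add_apply]
    simp only [boundedIndicator_apply]
    by_cases hxA : x ∈ A <;> by_cases hxB : x ∈ B <;> simp [hxA, hxB]

theorem conullFilter_neBot (hm : IsLeftInvariantMean m) : hm.conullFilter.NeBot := by
  refine ⟨fun h => ?_⟩
  have h0 : m (boundedIndicator (∅ : Set G)ᶜ) = 0 := Filter.empty_mem_iff_bot.2 h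
  have h1 : boundedIndicator (∅ : Set G)ᶜ = 1 := by
    ext x
    rw [boundedIndicator_apply, Set.compl_empty, Set.indicator_univ]
    rfl
  rw [h1, hm.map_one] at h0
  exact one_ne_zero h0

end IsLeftInvariantMean

section

variable [LinearOrder G] [MulLeftMono G]

/-- The set where Conrad's condition fails for `g`, `h` wanders under powers of `g * h`. -/
theorem pow_mul_notMem_conrad_failure (g h : G) (n : ℕ) (hn : n ≠ 0) (x : G)
    (hx : x ∈ {x : G | x < g * x ∧ x < h * x ∧ g * h ^ 2 * x ≤ h * x}) :
    (g * h) ^ n * x ∉ {x : G | x < g * x ∧ x < h * x ∧ g * h ^ 2 * x ≤ h * x} := by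
  obtain ⟨hg, hh, hgh⟩ := hx
  rintro ⟨hcon, -, -⟩
  -- Powers of `g * h` do not raise `h * x`, but they raise `x`. A return point `z = (g * h) ^ n *
  -- x` would satisfy `z < g * z < g * h * x ≤ z`.
  have hdown : ∀ j : ℕ, (g * h) ^ j * (h * x) ≤ h * x := by
    intro j
    induction j with
    | zero => simp
    | succ j ih =>
      rw [pow_succ, mul_assoc]
      refine (mul_le_mul_right ?_ _).trans ih
      simpa [pow_two, mul_assoc] using hgh
  have hup1 : x < g * h * x := by
    rw [mul_assoc]
    exact hg.trans (mul_lt_mul_right hh g)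
  have hup : ∀ j : ℕ, g * h * x ≤ (g * h) ^ (j + 1) * x := by
    intro j
    induction j with
    | zero => simp
    | succ j ih =>
      refine ih.trans ?_
      rw [pow_succ (g * h) (j + 1), mul_assoc]
      exact mul_le_mul_right hup1.le _
  obtain ⟨j, rfl⟩ := Nat.exists_eq_succ_of_ne_zero hn
  have h1 : (g * h) ^ (j + 1) * x < h * x := (mul_lt_mul_right hh _).trans_le (hdown _)
  have h2 : g * ((g * h) ^ (j + 1) * x) < g * h * x := by
    rw [mul_assoc g h x]
    exact mul_lt_mul_right h1 g
  exact lt_irrefl _ (hcon.trans (h2.trans_le (hup j)))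

/-- For `a ≠ 1` each `x` satisfies `x < a * x` or `x < a⁻¹ * x`; the ultrafilter decides which holds
almost everywhere. -/
theorem isPositiveCone_ultrafilter (U : Ultrafilter G) :
    IsPositiveCone {a : G | ∀ᶠ x in U, x < a * x} where
  mul_mem := by
    intro a b ha hb
    filter_upwards [ha, hb] with x hxa hxb
    rw [mul_assoc]
    exact hxa.trans (mul_lt_mul_right hxb a)
  one_notMem := by simp [U.neBot.ne]
  mem_or_inv_mem := by
    intro a ha
    refine or_iff_not_imp_left.2 fun h => ?_
    filter_upwards [Ultrafilter.eventually_not.2 h] with x hx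
    rw [lt_inv_mul_iff_mul_lt]
    exact lt_of_le_of_ne (not_lt.1 hx) fun h' => ha (mul_eq_right.1 h')

end

end Means

/-- An amenable left-orderable group has a Conradian left order. -/
theorem exists_isConradian {G : Type*} [Group G] (hamen : IsAmenableGroup G)
    (hord : IsLeftOrderable G) :
    ∃ _ : LinearOrder G, MulLeftMono G ∧ IsConradian G := by
  obtain ⟨m, hm⟩ := hamen
  obtain ⟨P, hP, hPC⟩ : ∃ P : Set G, IsPositiveCone P ∧
      ∀ g h : G, g ∈ P → h ∈ P → h⁻¹ * (g * h ^ 2) ∈ P := by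
    obtain ⟨_, hmul⟩ := hord
    have : MulLeftMono G := ⟨hmul⟩
    have := hm.conullFilter_neBot
    let U := Ultrafilter.of hm.conullFilter
    refine ⟨_, isPositiveCone_ultrafilter U, fun g h hg hh => ?_⟩
    have hnull : {x : G | x < g * x ∧ x < h * x ∧ g * h ^ 2 * x ≤ h * x}ᶜ ∈
        hm.conullFilter := by
      change m (boundedIndicator _ᶜᶜ) = 0
      rw [compl_compl]
      exact hm.indicator_eq_zero_of_wandering (pow_mul_notMem_conrad_failure g h)
    have hU : {x : G | x < g * x ∧ x < h * x ∧ g * h ^ 2 * x ≤ h * x}ᶜ ∈ U :=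
      Ultrafilter.of_le _ hnull
    filter_upwards [hU, hg, hh] with x hx hxg hxh
    rw [mul_assoc, lt_inv_mul_iff_mul_lt]
    exact lt_of_not_ge fun hle => hx ⟨hxg, hxh, hle⟩
  let := hP.linearOrder
  have hmono := hP.mulLeftMono
  refine ⟨hP.linearOrder, hmono, fun g h hg hh => ?_⟩
  have := hP.one_lt_iff.2 (hPC g h (hP.one_lt_iff.1 hg) (hP.one_lt_iff.1 hh))
  simpa using mul_lt_mul_right this h

theorem mainTheorem2 (G : Type*) [Group G] (hamen : IsAmenableGroup G)
    (hord : IsLeftOrderable G) : IsLocallyIndicable G := by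
  intro H hfg hH
  obtain ⟨_, _, hC⟩ := exists_isConradian hamen hord
  have hCH : IsConradian H := fun g h hg hh => hC g h hg hh
  have : MulLeftMono H := ⟨fun a b c hbc => mul_le_mul_right (α := G) hbc (a : G)⟩
  have : Group.FG H := (Group.fg_iff_subgroup_fg H).2 hfg
  have : Nontrivial H := (Subgroup.nontrivial_iff_ne_bot H).2 hH
  exact hCH.exists_hom_int_ne_one
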